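/- Let $\Sigma_0=\mathbb Z$ with generator $\sigma$, let $\Sigma_1=\mathbb Z/t_1\mathbb Z\oplus\dots\oplus\mathbb Z/t_s\mathbb Z$ with all $t_i\ge 2$, and let $\Sigma=\Sigma_0\oplus\Sigma_1$. For a subgroup $\Sigma'\subset\Sigma$, a $\Sigma'$-ring is a commutative ring with an action of $\Sigma'$ by ring automorphisms; a $\Sigma'$-ideal is an ideal stable under $\Sigma'$; a $\Sigma'$-ring is $\Sigma'$-simple if it is nonzero and its only $\Sigma'$-ideals are $(0)$ and the whole ring; a $\Sigma'$-pseudofield is a $\Sigma'$-simple $\Sigma'$-ring which is absolutely flat, i.e. over which every module is flat. For a $\Sigma'$-ring $R$, let $R\{y_1,\dots,y_n\}_{\Sigma'}=R[\tau y_i : \tau\in\Sigma',\ 1\le i\le n]$ be the ring of $\Sigma'$-polynomials, with the natural action of $\Sigma'$. A $\Sigma'$-pseudofield $R$ is called $\Sigma'$-closed if for every $n\ge 0$ and every $\Sigma'$-ideal $I\subset R\{y_1,\dots,y_n\}_{\Sigma'}$ one has $\sqrt I=\mathbb I(\mathbb V(I))$, where $\mathbb V(I)\subset R^n$ is the set of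 common zeros of $I$ and $\mathbb I(X)$ is the ideal of all $\Sigma'$-polynomials vanishing on $X\subset R^n$ (the variable $\tau y_i$ takes the value $\tau(a_i)$ at $a\in R^n$). Let $K$ be a Noetherian $\Sigma$-pseudofield such that its ring of $\sigma$-constants $K^\sigma=\{a\in K:\sigma(a)=a\}$ is a $\Sigma_1$-closed pseudofield, let $n\ge 0$, and let $A\in\mathrm{GL}_n(K)$. A Picard–Vessiot ring for the equation $\sigma Y=AY$ is a $\Sigma$-ring $R$ containing $K$ as a $\Sigma$-subring such that $R$ is $\Sigma$-simple and there is a matrix $F\in\mathrm{GL}_n(R)$ with $\sigma F=AF$ for which $R$ is generated as a $K$-algebra by the elements $\tau(F_{ij})$ and $\tau(1/\det F)$, $\tau\in\Sigma$, $1\le i,j\le n$. Then a Picard–Vessiot ring for $\sigma Y=AY$ exists, and it is unique up to isomorphism: for any two Picard–Vessiot rings $R_1$, $R_2$ for $\sigma Y=AY$ there is a $K$-algebra isomorphism $R_1\to R_2$ that commutes with the action of $\Sigma$. -/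

import Mathlib

universe u v w

namespace DifferenceAlgebra

/-! ### The groups `Σ₀`, `Σ₁`, `Σ` -/

/-- `Σ = ℤ ⊕ ℤ/t₁ ⊕ ⋯ ⊕ ℤ/tₛ`, written multiplicatively. -/
abbrev SigmaGroup {s : ℕ} (t : Fin s → ℕ) : Type :=
  Multiplicative (ℤ × ((i : Fin s) → ZMod (t i)))

/-- The generator `σ` of the first summand of `Σ`. -/
def sigma {s : ℕ} (t : Fin s → ℕ) : SigmaGroup t :=
  Multiplicative.ofAdd (1, 0)

/-- `Σ₀`, the subgroup of `Σ` generated by `σ`. -/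
abbrev sigmaZero {s : ℕ} (t : Fin s → ℕ) : Subgroup (SigmaGroup t) :=
  Subgroup.zpowers (sigma t)

/-- `Σ₁ = ℤ/t₁ ⊕ ⋯ ⊕ ℤ/tₛ` as a subgroup of `Σ`. -/
def sigmaOne {s : ℕ} (t : Fin s → ℕ) : Subgroup (SigmaGroup t) where
  carrier := {g | g.toAdd.1 = 0}
  one_mem' := rfl
  mul_mem' := by
    intro a b ha hb
    simp only [Set.mem_ofPred_eq, toAdd_mul, Prod.fst_add] at *
    rw [ha, hb, add_zero]
  inv_mem' := by
    intro a ha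
    simp only [Set.mem_ofPred_eq, toAdd_inv, Prod.fst_neg] at *
    rw [ha, neg_zero]

/-! ### Difference ideals, simple difference rings, pseudofields

A `G`-ring is a commutative ring `R` with `[MulSemiringAction G R]`. -/

/-- `I` is a `G`-ideal: `g a ∈ I` for all `g ∈ G` and `a ∈ I`. -/
def IsDiffIdeal (G : Type*) {R : Type*} [Group G] [CommRing R] [MulSemiringAction G R]
    (I : Ideal R) : Prop :=
  ∀ g : G, ∀ a ∈ I, g • a ∈ I

/-- A simple `G`-ring: a nonzero `G`-ring whose only `G`-ideals are `(0)` and the whole ring. -/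
structure IsDiffSimple (G R : Type*) [Group G] [CommRing R] [MulSemiringAction G R] : Prop where
  nontrivial : Nontrivial R
  eq_bot_or_eq_top : ∀ I : Ideal R, IsDiffIdeal G I → I = ⊥ ∨ I = ⊤

/-- A ring is absolutely flat if every module over it is flat. -/
def IsAbsolutelyFlat (R : Type u) [CommRing R] : Prop :=
  ∀ (M : Type u) [AddCommGroup M] [Module R M], Module.Flat R M

/-- A `G`-pseudofield: an absolutely flat simple `G`-ring. -/
structure IsPseudofield (G : Type*) (R : Type u) [Group G] [CommRing R]
    [MulSemiringAction G R] : Prop where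
  absolutelyFlat : IsAbsolutelyFlat R
  simple : IsDiffSimple G R

/-! ### Difference polynomials -/

/-- The ring `R{Y}_G = R[g y | g ∈ G, y ∈ Y]` of difference polynomials; the variable with index
`(g, y)` stands for `g y`. -/
def DiffPoly (G R Y : Type*) [CommRing R] : Type _ :=
  MvPolynomial (G × Y) R

noncomputable instance (G R Y : Type*) [CommRing R] : CommRing (DiffPoly G R Y) :=
  inferInstanceAs (CommRing (MvPolynomial (G × Y) R))

namespace DiffPoly

variable {G R Y : Type*} [CommRing R]

/-- The constant difference polynomials. -/
noncomputable def C : R →+* DiffPoly G R Y :=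
  (MvPolynomial.C : R →+* MvPolynomial (G × Y) R)

/-- The variable `g y`. -/
noncomputable def X (g : G) (y : Y) : DiffPoly G R Y :=
  (MvPolynomial.X (g, y) : MvPolynomial (G × Y) R)

theorem hom_ext {S : Type*} [CommRing S] {f f' : DiffPoly G R Y →+* S}
    (hC : ∀ r, f (C r) = f' (C r)) (hX : ∀ g y, f (X g y) = f' (X g y)) : f = f' :=
  MvPolynomial.ringHom_ext hC (fun v => hX v.1 v.2)

variable [Group G] [MulSemiringAction G R]

/-- The action of `g ∈ G` on `R{Y}_G`: it acts on coefficients through the action on `R` and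
sends the variable `h y` to `(g h) y`. -/
noncomputable def act (g : G) : DiffPoly G R Y →+* DiffPoly G R Y :=
  MvPolynomial.eval₂Hom ((C : R →+* DiffPoly G R Y).comp (MulSemiringAction.toRingHom G R g))
    (fun v : G × Y => X (g * v.1) v.2)

theorem act_C (g : G) (r : R) : act g (C r : DiffPoly G R Y) = C (g • r) :=
  MvPolynomial.eval₂Hom_C _ _ _

theorem act_X (g h : G) (y : Y) : act g (X h y : DiffPoly G R Y) = X (g * h) y :=
  MvPolynomial.eval₂Hom_X' _ _ _

theorem act_one : act (1 : G) = RingHom.id (DiffPoly G R Y) :=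
  hom_ext (fun r => by rw [act_C, one_smul, RingHom.id_apply])
    (fun g y => by rw [act_X, one_mul, RingHom.id_apply])

theorem act_mul (g h : G) :
    act (g * h) = (act g : DiffPoly G R Y →+* DiffPoly G R Y).comp (act h) :=
  hom_ext (fun r => by rw [RingHom.comp_apply, act_C, act_C, act_C, mul_smul])
    (fun k y => by rw [RingHom.comp_apply, act_X, act_X, act_X, mul_assoc])

noncomputable instance : MulSemiringAction G (DiffPoly G R Y) where
  smul g p := act g p
  one_smul p := congrArg (fun f : DiffPoly G R Y →+* DiffPoly G R Y => f p) act_one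
  mul_smul g h p := congrArg (fun f : DiffPoly G R Y →+* DiffPoly G R Y => f p) (act_mul g h)
  smul_zero g := map_zero (act g)
  smul_add g := map_add (act g)
  smul_one g := map_one (act g)
  smul_mul g := map_mul (act g)

/-- Evaluation of a difference polynomial at a point `a`: the variable `g y` takes the
value `g (a y)`. -/
noncomputable def evalAt (a : Y → R) : DiffPoly G R Y →+* R :=
  MvPolynomial.eval₂Hom (RingHom.id R) (fun v : G × Y => v.1 • a v.2)

/-- `V(E)`: the set of common zeros in `R^Y` of a set `E` of difference polynomials. -/
def zeroSet (E : Set (DiffPoly G R Y)) : Set (Y → R) :=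
  {a | ∀ p ∈ E, evalAt a p = 0}

/-- `I(X)`: the ideal of all difference polynomials that vanish on `X ⊆ R^Y`. -/
def vanishingIdeal (X : Set (Y → R)) : Ideal (DiffPoly G R Y) where
  carrier := {p | ∀ a ∈ X, evalAt a p = 0}
  zero_mem' := fun a _ => map_zero (evalAt a)
  add_mem' := fun {p q} hp hq a ha => by rw [map_add, hp a ha, hq a ha, add_zero]
  smul_mem' := fun c p hp a ha => by rw [smul_eq_mul, map_mul, hp a ha, mul_zero]

end DiffPoly

/-- A difference closed `G`-pseudofield: `√I = I(V(I))` for every `n` and every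
`G`-ideal `I` of `R{y₁, …, yₙ}_G`. -/
structure IsDiffClosedPseudofield (G : Type*) (R : Type u) [Group G] [CommRing R]
    [MulSemiringAction G R] : Prop where
  pseudofield : IsPseudofield G R
  radical_eq : ∀ (n : ℕ) (I : Ideal (DiffPoly G R (Fin n))), IsDiffIdeal G I →
    I.radical = DiffPoly.vanishingIdeal (DiffPoly.zeroSet (I : Set (DiffPoly G R (Fin n))))

/-! ### Constants -/

/-- For commuting actions, the ring of `H`-constants is stable under every subgroup `H'`; this
makes the ring of `H`-constants an `H'`-ring. -/
instance {G R : Type*} [CommGroup G] [CommRing R] [MulSemiringAction G R] (H H' : Subgroup G) :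
    IsInvariantSubring H' (FixedPoints.subring R H) where
  smul_mem := by
    intro g x hx h
    rw [smul_comm h g x, hx h]

/-! ### Picard–Vessiot rings -/

section PicardVessiot

variable {s : ℕ} (t : Fin s → ℕ) {K : Type*} [CommRing K] [MulSemiringAction (SigmaGroup t) K]
  {n : ℕ} (A : GL (Fin n) K)
  (R : Type*) [CommRing R] [Algebra K R] [MulSemiringAction (SigmaGroup t) R]

/-- `F ∈ GLₙ(R)` is a fundamental matrix of `σ Y = A Y`: `σ F = A F`. -/
def IsFundamentalMatrix {R : Type*} [CommRing R] [Algebra K R]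
    [MulSemiringAction (SigmaGroup t) R] (F : GL (Fin n) R) : Prop :=
  (F : Matrix (Fin n) (Fin n) R).map (fun x => sigma t • x) =
    (A : Matrix (Fin n) (Fin n) K).map (algebraMap K R) * (F : Matrix (Fin n) (Fin n) R)

/-- The `Σ`-ring `R` contains the `Σ`-ring `K` (through `algebraMap K R`) and is a Picard–Vessiot
ring for `σ Y = A Y`: it is `Σ`-simple, and there is a fundamental matrix `F` in `GLₙ(R)` such that
`R` is generated, as a `K`-algebra, by the `Σ`-translates of the entries of `F` and of `1 / det F`.
-/
structure IsPicardVessiotRing : Prop where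
  algebraMap_injective : Function.Injective (algebraMap K R)
  algebraMap_smul : ∀ (g : SigmaGroup t) (a : K), algebraMap K R (g • a) = g • algebraMap K R a
  simple : IsDiffSimple (SigmaGroup t) R
  exists_fundamentalMatrix : ∃ F : GL (Fin n) R, IsFundamentalMatrix t A F ∧
    Algebra.adjoin K
      ({x : R | ∃ (g : SigmaGroup t) (i j : Fin n), x = g • F i j} ∪
        {x : R | ∃ g : SigmaGroup t,
          x = g • (((Matrix.GeneralLinearGroup.det F)⁻¹ : Rˣ) : R)}) = ⊤

end PicardVessiot

end DifferenceAlgebra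

open DifferenceAlgebra

/-!
Existence. The difference ring of functions `Σ → K` contains `K` as the ring of constant functions,
and there a fundamental matrix can be written down (`exists_isFundamentalMatrix_functionRing`). The
subalgebra generated by the translates of its entries and of its inverse determinant is a `Σ`-ring; a simple quotient of it is a Picard–Vessiot
ring (`exists_isPicardVessiotRing`).

Uniqueness. Two Picard–Vessiot rings embed in a common simple `Σ`-ring `T`, a simple quotient of
their tensor product (`exists_isDiffSimple_compositum`). There the two fundamental matrices differ
by an invertible matrix of `σ`-constants. If `T` has no `σ`-constants outside `K`, both rings have
the same image in `T` (`adjoin_translates_le_of_isFundamentalMatrix`), and are thus isomorphic.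

That `T` has no new constants is the heart of the matter
(`exists_algebraMap_eq_of_forall_smul_eq`), and the only place where the closedness of `C = K^σ`
enters. Since `Σ₁` is finite and `σ F = A F`, the ring `T` is a `K`-algebra of finite type
(`fg_adjoin_translates`). For a `σ`-constant `d` of `T`, consider the polynomial relations over `K`
between the `Σ₁`-translates of `d`. They form a `σ`-stable ideal, hence are generated by relations
over `C` (`le_map_comap_subtype_of_stable`): `K` and `C` are semisimple rings, and a `σ`-stable
ideal of `K` is generated by an idempotent of `C`. Consequently a `Σ₁`-point of `C` that satisfies
the relations over `C` satisfies all of them, and by closedness such points are dense among the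
solutions. Chevalley's theorem says that sufficiently general primes over the ideal of relations
lift to `T` (`exists_notMem_ker_forall_isPrime_exists_comap_eq`), so that for some `c ∈ C` all
translates of `d - c` lie in one prime of `T`. As `T` is simple, `d = c`.
-/

namespace DifferenceAlgebra

/-! ### Absolutely flat rings -/

theorem IsAbsolutelyFlat.exists_isIdempotentElem {R : Type u} [CommRing R]
    (h : IsAbsolutelyFlat R) {I : Ideal R} (hI : I.FG) :
    ∃ e : R, IsIdempotentElem e ∧ I = Ideal.span {e} := by
  have : I.Pure := h (R ⧸ I)
  exact (I.isIdempotentElem_iff_of_fg hI).1 I.isIdempotentElem_of_pure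

theorem IsAbsolutelyFlat.isReduced {R : Type u} [CommRing R] (h : IsAbsolutelyFlat R) :
    IsReduced R := by
  refine ⟨fun x ⟨n, hn⟩ => ?_⟩
  obtain ⟨e, he, hx⟩ := h.exists_isIdempotentElem (I := Ideal.span {x}) ⟨{x}, by simp⟩
  obtain ⟨a, rfl⟩ := Ideal.mem_span_singleton'.1 (hx ▸ Ideal.mem_span_singleton_self e)
  have h0 : a * x = 0 := by
    cases n with
    | zero =>
      have : Subsingleton R := subsingleton_of_zero_eq_one (by simpa using hn.symm)
      exact Subsingleton.elim _ _
    | succ n => rw [← he.pow_succ_eq n, mul_pow, hn, mul_zero]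
  have hx' : x ∈ Ideal.span {x} := Ideal.mem_span_singleton_self x
  rw [hx, h0] at hx'
  simpa using hx'

/-- The complement of `eR`, for an idempotent `e`, is `(1 - e)R`. -/
theorem isSemisimpleRing_of_forall_exists_isIdempotentElem {R : Type*} [CommRing R]
    (h : ∀ I : Ideal R, ∃ e : R, IsIdempotentElem e ∧ I = Ideal.span {e}) :
    IsSemisimpleRing R := by
  refine (isSemisimpleModule_iff R R).2 ⟨fun I => ?_⟩
  obtain ⟨e, he, rfl⟩ := h I
  refine ⟨Ideal.span {1 - e}, ?_, ?_⟩
  · rw [Submodule.disjoint_def]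
    intro x hx hx'
    obtain ⟨a, rfl⟩ := Ideal.mem_span_singleton'.1 hx
    obtain ⟨b, hb⟩ := Ideal.mem_span_singleton'.1 hx'
    have he' : e * e = e := he
    calc a * e = (a * e) * e := by rw [mul_assoc, he']
      _ = b * (e - e * e) := by rw [← hb]; ring
      _ = 0 := by rw [he', sub_self, mul_zero]
  · rw [codisjoint_iff, Ideal.eq_top_iff_one]
    exact Submodule.mem_sup.2 ⟨e, Ideal.mem_span_singleton_self e, 1 - e,
      Ideal.mem_span_singleton_self _, by ring⟩

/-- An ideal `I` of `C` has the same extension to `K` as some finitely generated `I₀ ≤ I`, and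
`I₀ = eC` with `e` idempotent; multiplication by `e` fixes `I`, whence `I = eC`. -/
theorem IsAbsolutelyFlat.exists_isIdempotentElem_of_subring {K : Type u} [CommRing K]
    [IsNoetherianRing K] (C : Subring K) (hC : IsAbsolutelyFlat C) (I : Ideal C) :
    ∃ e : C, IsIdempotentElem e ∧ I = Ideal.span {e} := by
  classical
  obtain ⟨s, hs, hfg⟩ := (Submodule.fg_span_iff_fg_span_finset_subset
    (R := K) ((C.subtype : C → K) '' (I : Set C))).1 (IsNoetherian.noetherian _)
  obtain ⟨s', hs', rfl⟩ := Finset.subset_set_image_iff.1 hs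
  obtain ⟨e, he, hI⟩ := hC.exists_isIdempotentElem (I := Ideal.span (s' : Set C)) ⟨s', rfl⟩
  have hmul : ∀ x ∈ Ideal.span (s' : Set C), e * x = x := by
    intro x hx
    rw [hI] at hx
    obtain ⟨a, rfl⟩ := Ideal.mem_span_singleton'.1 hx
    rw [mul_left_comm, he.eq]
  refine ⟨e, he, le_antisymm (fun x hx => ?_) (hI ▸ Ideal.span_le.2 hs')⟩
  have hxK : (x : K) ∈ Ideal.span ((C.subtype : C → K) '' (s' : Set C)) := by
    have : (x : K) ∈ Submodule.span K ((C.subtype : C → K) '' (I : Set C)) :=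
      Submodule.subset_span ⟨x, hx, rfl⟩
    rw [hfg] at this
    simpa using this
  have key : ∀ y ∈ Ideal.span ((C.subtype : C → K) '' (s' : Set C)), (e : K) * y = y := by
    intro y hy
    induction hy using Submodule.span_induction with
    | mem y hy =>
      obtain ⟨z, hz, rfl⟩ := hy
      simpa using congrArg C.subtype (hmul z (Ideal.subset_span hz))
    | zero => simp
    | add a b _ _ ha hb => rw [mul_add, ha, hb]
    | smul a b _ hb => rw [smul_eq_mul, mul_left_comm, hb]
  exact Ideal.mem_span_singleton'.2 ⟨x, by
    rw [mul_comm]; exact Subtype.ext (by simpa using key x hxK)⟩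

/-! ### Descent of stable ideals to the constants -/

section Descent

variable {H K : Type*} [Group H] [CommRing K] [MulSemiringAction H K]

/-- If `eK` is stable under `H`, then `h e` divides `e` and conversely, for every `h`; idempotents
generating the same ideal are equal. -/
theorem smul_eq_self_of_isIdempotentElem {e : K} (he : IsIdempotentElem e)
    (hI : IsDiffIdeal H (Ideal.span {e})) (h : H) : h • e = e := by
  have key : ∀ h : H, h • e * e = h • e := fun h => by
    obtain ⟨a, ha⟩ := Ideal.mem_span_singleton'.1 (hI h e (Ideal.mem_span_singleton_self e))
    rw [← ha, mul_assoc, he.eq]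
  have h2 := congrArg (fun x => h • x) (key h⁻¹)
  simp only [smul_mul', smul_inv_smul] at h2
  rw [← key h, mul_comm, h2]

open MvPolynomial

/-- A nonzero element of minimal support, normalized so that one coefficient is an idempotent
constant, has all its coefficients constant. -/
theorem exists_mem_forall_smul_coeff_eq {ι : Type*}
    (hK : ∀ I : Ideal K, ∃ e : K, IsIdempotentElem e ∧ I = Ideal.span {e})
    (W : Submodule K (MvPolynomial ι K))
    (hW : ∀ (h : H), ∀ f ∈ W, map (MulSemiringAction.toRingHom H K h) f ∈ W) (hne : W ≠ ⊥) :
    ∃ f ∈ W, f ≠ 0 ∧ ∀ (h : H) m, h • coeff m f = coeff m f := by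
  classical
  obtain ⟨f₀, hf₀, hf₀'⟩ := W.exists_mem_ne_zero_of_ne_bot hne
  obtain ⟨f, ⟨hfW, hf⟩, hmin⟩ := exists_minimalFor_of_wellFoundedLT
    (fun f : MvPolynomial ι K => f ∈ W ∧ f ≠ 0) (fun f => f.support) ⟨f₀, hf₀, hf₀'⟩
  obtain ⟨m, hm⟩ := support_nonempty.2 hf
  let I : Ideal K :=
    { carrier := {a | ∃ g ∈ W, g.support ⊆ f.support ∧ coeff m g = a}
      zero_mem' := ⟨0, W.zero_mem, by simp, by simp⟩
      add_mem' := by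
        rintro _ _ ⟨g, hg, hgs, rfl⟩ ⟨g', hg', hgs', rfl⟩
        exact ⟨g + g', W.add_mem hg hg', support_add.trans (Finset.union_subset hgs hgs'),
          coeff_add _ _ _⟩
      smul_mem' := by
        rintro a _ ⟨g, hg, hgs, rfl⟩
        exact ⟨a • g, W.smul_mem a hg, support_smul.trans hgs, coeff_smul _ _ _⟩ }
  have hI : IsDiffIdeal H I := by
    rintro h _ ⟨g, hg, hgs, rfl⟩
    exact ⟨_, hW h g hg, (support_map_subset _ _).trans hgs, coeff_map _ _ _⟩
  obtain ⟨e, he, hIe⟩ := hK I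
  have hfix := smul_eq_self_of_isIdempotentElem he (hIe ▸ hI)
  have he0 : e ≠ 0 := by
    rintro rfl
    have : coeff m f ∈ I := ⟨f, hfW, subset_rfl, rfl⟩
    rw [hIe] at this
    exact mem_support_iff.1 hm (by simpa using this)
  obtain ⟨g, hg, hgs, hgm⟩ : e ∈ I := hIe ▸ Ideal.mem_span_singleton_self e
  refine ⟨g, hg, ?_, fun h m' => ?_⟩
  · rintro rfl
    exact he0 (by simpa using hgm.symm)
  -- `h g - g` has no monomial `m`, so its support is strictly smaller than that of `f`
  have h0 : map (MulSemiringAction.toRingHom H K h) g - g = 0 := by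
    by_contra hne
    have hle : (map (MulSemiringAction.toRingHom H K h) g - g).support ⊆ f.support :=
      (support_sub _ _ _).trans (Finset.union_subset ((support_map_subset _ _).trans hgs) hgs)
    have := hmin ⟨W.sub_mem (hW h g hg) hg, hne⟩ hle hm
    rw [mem_support_iff, coeff_sub, coeff_map, hgm] at this
    exact this (sub_eq_zero.2 (hfix h))
  have := congrArg (coeff m') (sub_eq_zero.1 h0)
  rwa [coeff_map] at this

/-- The coefficients of elements of `K[ι]` fixed by `H` lie in the constants, so that such an
element comes from a polynomial over the constants. -/
theorem exists_map_subtype_eq {ι : Type*} {f : MvPolynomial ι K}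
    (hf : ∀ (h : H) m, h • coeff m f = coeff m f) :
    ∃ u : MvPolynomial ι (FixedPoints.subring K H),
      map (FixedPoints.subring K H).subtype u = f := by
  have : f ∈ Set.range (map (FixedPoints.subring K H).subtype : _ →+* MvPolynomial ι K) := by
    rw [mem_range_map_iff_coeffs_subset]
    intro x hx
    obtain ⟨m, _, rfl⟩ := mem_coeffs_iff.1 hx
    exact ⟨⟨_, fun h => hf h m⟩, rfl⟩
  exact this

/-- Descent: an `H`-stable ideal `J` of `K[ι]` is generated by its elements with constant
coefficients. A linear projection `p` of `C[ι]`, `C` the constants, with kernel `J ∩ C[ι]` extends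
to `K[ι]`; the image of `J` under it is a stable submodule of `J` that contains no constant element
but `0`, so it vanishes. -/
theorem le_map_comap_subtype_of_stable {ι : Type*}
    (hK : ∀ I : Ideal K, ∃ e : K, IsIdempotentElem e ∧ I = Ideal.span {e})
    [IsSemisimpleRing (FixedPoints.subring K H)]
    (J : Ideal (MvPolynomial ι K))
    (hJ : ∀ (h : H), ∀ f ∈ J, map (MulSemiringAction.toRingHom H K h) f ∈ J) :
    J ≤ (J.comap (map (FixedPoints.subring K H).subtype)).map
      (map (FixedPoints.subring K H).subtype) := by
  let C := FixedPoints.subring K H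
  let i : MvPolynomial ι C →+* MvPolynomial ι K := map C.subtype
  have hmapi : ∀ (h : H) (u : MvPolynomial ι C),
      map (MulSemiringAction.toRingHom H K h) (i u) = i u := fun h u => by
    ext m
    rw [coeff_map, coeff_map]
    exact (coeff m u).2 h
  have hi_smul : ∀ (c : C) (u : MvPolynomial ι C), i (c • u) = (c : K) • i u := fun c u => by
    rw [smul_eq_C_mul, map_mul, smul_eq_C_mul]
    congr 1
    exact map_C _ _
  let U : Submodule C (MvPolynomial ι C) := (J.comap i).restrictScalars C
  obtain ⟨U', hU⟩ := exists_isCompl U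
  let p : MvPolynomial ι C →ₗ[C] MvPolynomial ι C := U'.projection U hU.symm
  let pK : MvPolynomial ι K →ₗ[K] MvPolynomial ι K :=
    (basisMonomials ι K).constr K fun m => i (p (monomial m 1))
  have hpK : ∀ m a, pK (monomial m a) = a • i (p (monomial m 1)) := fun m a => by
    have : monomial m a = a • basisMonomials ι K m := by
      rw [coe_basisMonomials, smul_monomial, smul_eq_mul, mul_one]
    rw [this, map_smul, Module.Basis.constr_basis]
  have hpKi : ∀ u, pK (i u) = i (p u) := fun u => by
    induction u using MvPolynomial.induction_on' with
    | monomial m a =>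
      have : (monomial m a : MvPolynomial ι C) = a • monomial m 1 := by
        rw [smul_monomial, smul_eq_mul, mul_one]
      rw [show i (monomial m a) = monomial m (a : K) from map_monomial _ _ _, hpK, this, map_smul,
        hi_smul]
    | add u v hu hv => rw [map_add, map_add, hu, hv, map_add, map_add]
  have hpK_idem : ∀ f, pK (pK f) = pK f := fun f => by
    induction f using MvPolynomial.induction_on' with
    | monomial m a =>
      rw [hpK, map_smul, hpKi]
      congr 2
      exact (Submodule.projection_eq_self_iff hU.symm _).2
        (Submodule.projection_apply_mem hU.symm _)
    | add u v hu hv => rw [map_add, map_add, hu, hv]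
  have hpK_map : ∀ (h : H) f, pK (map (MulSemiringAction.toRingHom H K h) f) =
      map (MulSemiringAction.toRingHom H K h) (pK f) := fun h f => by
    induction f using MvPolynomial.induction_on' with
    | monomial m a =>
      rw [map_monomial, hpK, hpK, smul_eq_C_mul, smul_eq_C_mul, map_mul, map_C, hmapi]
    | add u v hu hv => rw [map_add, map_add, hu, hv, map_add, map_add]
  have hpK_sub : ∀ f, f - pK f ∈ (J.comap i).map i := fun f => by
    induction f using MvPolynomial.induction_on' with
    | monomial m a =>
      have h1 : monomial m a = a • i (monomial m 1) := by
        rw [show i (monomial m 1) = monomial m (C.subtype 1) from map_monomial _ _ _, map_one,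
          smul_monomial, smul_eq_mul, mul_one]
      rw [hpK]
      nth_rw 1 [h1]
      rw [← smul_sub, smul_eq_C_mul, ← map_sub]
      exact Ideal.mul_mem_left _ _ (Ideal.mem_map_of_mem i
        (Submodule.sub_projection_mem hU.symm (monomial m 1)))
    | add u v hu hv =>
      rw [map_add, add_sub_add_comm]
      exact Ideal.add_mem _ hu hv
  let W : Submodule K (MvPolynomial ι K) := (J.restrictScalars K).map pK
  have hWJ : ∀ w ∈ W, w ∈ J := by
    rintro _ ⟨f, hf, rfl⟩
    have := J.sub_mem hf (Ideal.map_comap_le (hpK_sub f))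
    rwa [sub_sub_cancel] at this
  have hW : W = ⊥ := by
    by_contra hne
    obtain ⟨_, ⟨f, hf, rfl⟩, hw0, hw⟩ := exists_mem_forall_smul_coeff_eq (H := H) hK W (by
      rintro h _ ⟨f, hf, rfl⟩
      exact ⟨_, hJ h f hf, hpK_map h f⟩) hne
    obtain ⟨u, hu⟩ := exists_map_subtype_eq hw
    have huU : u ∈ U := by
      change i u ∈ J
      rw [show i u = pK f from hu]
      exact hWJ _ ⟨f, hf, rfl⟩
    refine hw0 ?_
    rw [← hpK_idem, ← hu, show pK (map _ u) = i (p u) from hpKi u,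
      (Submodule.projection_apply_eq_zero_iff hU.symm).2 huU, map_zero]
  intro f hf
  have h0 : pK f = 0 := by
    have : pK f ∈ W := ⟨f, hf, rfl⟩
    rwa [hW, Submodule.mem_bot] at this
  simpa [h0] using hpK_sub f

end Descent

section Coefficients

open MvPolynomial

/-- As `K` is projective over `C`, it has a coordinate system: elements `x` of `K` and functionals
`lₓ` with `a = ∑ lₓ(a) x` for all `a ∈ K`. Thus `f = ∑ x lₓ(f)`, where functionals are applied to
the coefficients. -/
theorem mem_map_of_forall_mapCoeff_mem {C K ι : Type*} [CommRing C] [CommRing K] [Algebra C K]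
    [Module.Projective C K] (I : Ideal (MvPolynomial ι C)) (f : MvPolynomial ι K)
    (hf : ∀ l : K →ₗ[C] C, ∑ m ∈ f.support, monomial m (l (coeff m f)) ∈ I) :
    f ∈ I.map (map (algebraMap C K)) := by
  classical
  obtain ⟨s, hs⟩ := Module.projective_def.1 (inferInstance : Module.Projective C K)
  let S : Finset K := f.support.biUnion fun m => (s (coeff m f)).support
  have key : f = ∑ x ∈ S, MvPolynomial.C x * map (algebraMap C K)
      (∑ m ∈ f.support, monomial m ((Finsupp.lapply x ∘ₗ s) (coeff m f))) := by
    conv_lhs => rw [f.as_sum]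
    simp only [map_sum, Finset.mul_sum, map_monomial, C_mul_monomial]
    rw [Finset.sum_comm]
    refine Finset.sum_congr rfl fun m hm => ?_
    rw [← map_sum]
    congr 1
    conv_lhs => rw [← hs (coeff m f), Finsupp.linearCombination_apply]
    rw [Finsupp.sum_of_support_subset (s := S) _ (Finset.subset_biUnion_of_mem
      (fun m => (s (coeff m f)).support) hm) _ (by simp)]
    refine Finset.sum_congr rfl fun x _ => ?_
    simp [Algebra.smul_def, mul_comm]
  rw [key]
  exact Ideal.sum_mem _ fun x _ => Ideal.mul_mem_left _ _ (Ideal.mem_map_of_mem _ (hf _))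

end Coefficients

/-! ### Generic lifting of primes -/

/-- The image of `Spec B → Spec A` is constructible and contains a prime `η` minimal over the
kernel. So it contains a set `V(g₁, …, gₙ) ∩ D(f₀)` through `η`; if `h ∉ η` lies in all other primes
minimal over the kernel, every prime that contains the kernel but not `f₀ h` belongs to this set. -/
theorem exists_notMem_ker_forall_isPrime_exists_comap_eq {A B : Type*} [CommRing A] [CommRing B]
    [IsNoetherianRing A] [Nontrivial B] [IsReduced B] (f : A →+* B) (hf : f.FiniteType) :
    ∃ b ∉ RingHom.ker f, ∀ p : Ideal A, p.IsPrime → RingHom.ker f ≤ p → b ∉ p →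
      ∃ P : Ideal B, P.IsPrime ∧ P.comap f = p := by
  classical
  have hrad : (RingHom.ker f).IsRadical := fun x ⟨n, hn⟩ => by
    rw [RingHom.mem_ker, map_pow] at hn
    exact (IsReduced.eq_zero _ ⟨n, hn⟩ : f x = 0)
  obtain ⟨m, hm⟩ := Ideal.exists_maximal B
  obtain ⟨η, hη, -⟩ := Ideal.exists_minimalPrimes_le (I := RingHom.ker f) (J := m.comap f)
    (Ideal.comap_mono bot_le)
  obtain ⟨Q, hQ, -, hQη⟩ := Ideal.exists_comap_eq_of_mem_minimalPrimes f (I := ⊥) η hη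
  obtain ⟨S, hS⟩ := PrimeSpectrum.exists_constructibleSetData_iff.2
    (PrimeSpectrum.isConstructible_range_comap (RingHom.FinitePresentation.of_finiteType.1 hf))
  have hmem : (⟨η, hη.1.1⟩ : PrimeSpectrum A) ∈ S.toSet := by
    rw [hS]
    exact ⟨⟨Q, hQ⟩, PrimeSpectrum.ext hQη⟩
  obtain ⟨D, hD, hηD⟩ := Set.mem_iUnion₂.1 hmem
  obtain ⟨hg, hf'⟩ := hηD
  -- `h ∉ η` lies in all the other minimal primes, so that it multiplies `η` into the kernel
  obtain ⟨h, hh, hhη⟩ : ∃ h, (∀ q ∈ (RingHom.ker f).minimalPrimes, q ≠ η → h ∈ q) ∧ h ∉ η := by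
    let s := ((RingHom.ker f).finite_minimalPrimes_of_isNoetherianRing A).toFinset.erase η
    have hs : ¬ s.inf id ≤ η := fun hle => by
      obtain ⟨q, hq, hqη⟩ := (Ideal.IsPrime.inf_le' hη.1.1).1 hle
      obtain ⟨hne, hq⟩ := Finset.mem_erase.1 hq
      rw [Set.Finite.mem_toFinset] at hq
      exact hne (le_antisymm hqη (hη.2 hq.1 hqη))
    obtain ⟨h, hh, hhη⟩ := SetLike.not_le_iff_exists.1 hs
    refine ⟨h, fun q hq hne => ?_, hhη⟩
    exact (Finset.inf_le (f := id) (Finset.mem_erase.2 ⟨hne, (Set.Finite.mem_toFinset _).2 hq⟩) :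
      s.inf id ≤ q) hh
  have hmul : ∀ x ∈ η, x * h ∈ RingHom.ker f := fun x hx => by
    rw [← hrad.radical, ← Ideal.sInf_minimalPrimes, Submodule.mem_sInf]
    intro q hq
    by_cases hqη : q = η
    · exact hqη ▸ Ideal.mul_mem_right _ _ hx
    · exact Ideal.mul_mem_left _ _ (hh q hq hqη)
  have hDf : D.f ∉ η := fun hmem => hf' (by simpa using hmem)
  refine ⟨D.f * h, fun hker => ?_, fun p hp hker hb => ?_⟩
  · exact (hη.1.1.mem_or_mem (hη.1.2 hker)).elim hDf hhη
  · have hp' : (⟨p, hp⟩ : PrimeSpectrum A) ∈ S.toSet := by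
      refine Set.mem_iUnion₂.2 ⟨D, hD, ?_,
        fun hDp => hb (Ideal.mul_mem_right _ _ (by simpa using hDp))⟩
      intro x hx
      exact (hp.mem_or_mem (hker (hmul x (hg hx)))).resolve_right
        fun hhp => hb (Ideal.mul_mem_left _ _ hhp)
    rw [hS] at hp'
    obtain ⟨P, hP⟩ := hp'
    exact ⟨P.asIdeal, P.isPrime, congrArg PrimeSpectrum.asIdeal hP⟩

/-! ### Simple difference rings -/

section Simple

variable {G R : Type*} [Group G] [CommRing R] [MulSemiringAction G R]

/-- The elements all of whose translates lie in a proper ideal `P` form a proper `G`-ideal. -/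
theorem IsDiffSimple.eq_zero_of_forall_smul_mem (hR : IsDiffSimple G R) {P : Ideal R}
    (hP : P ≠ ⊤) {x : R} (hx : ∀ g : G, g • x ∈ P) : x = 0 := by
  let I : Ideal R :=
    { carrier := {x | ∀ g : G, g • x ∈ P}
      zero_mem' := fun g => by rw [smul_zero]; exact P.zero_mem
      add_mem' := fun ha hb g => by rw [smul_add]; exact P.add_mem (ha g) (hb g)
      smul_mem' := fun c a ha g => by
        rw [smul_eq_mul, smul_mul']; exact P.mul_mem_left _ (ha g) }
  have hI : IsDiffIdeal G I := fun g a ha g' => by rw [smul_smul]; exact ha _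
  rcases hR.eq_bot_or_eq_top I hI with h | h
  · have : x ∈ I := hx
    rwa [h] at this
  · refine absurd ((Ideal.eq_top_iff_one P).2 ?_) hP
    have : (1 : R) ∈ I := h ▸ Submodule.mem_top
    simpa using this 1

theorem IsDiffSimple.isReduced (hR : IsDiffSimple G R) : IsReduced R := by
  have := hR.nontrivial
  refine ⟨fun x hx => hR.eq_zero_of_forall_smul_mem (P := nilradical R) (fun h => ?_) fun g => ?_⟩
  · obtain ⟨n, hn⟩ : (1 : R) ∈ nilradical R := h ▸ Submodule.mem_top
    simp at hn
  · exact hx.map (MulSemiringAction.toRingHom G R g)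

/-- Equivariant homomorphisms from a simple difference ring to a nonzero one are injective. -/
theorem IsDiffSimple.injective (hR : IsDiffSimple G R) {S : Type*} [CommRing S] [Nontrivial S]
    [MulSemiringAction G S] (f : R →+* S) (hf : ∀ (g : G) a, f (g • a) = g • f a) :
    Function.Injective f := by
  refine (RingHom.injective_iff_ker_eq_bot f).2 ((hR.eq_bot_or_eq_top _ ?_).resolve_right
    (RingHom.ker_ne_top f))
  intro g a ha
  rw [RingHom.mem_ker] at ha ⊢
  rw [hf, ha, smul_zero]

/-- Every nonzero difference ring has a simple quotient: divide by a maximal proper `G`-ideal. -/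
theorem exists_isDiffSimple_quotient (G : Type*) (R : Type u) [Group G] [CommRing R]
    [MulSemiringAction G R] [Nontrivial R] :
    ∃ (Q : Type u) (_ : CommRing Q) (_ : MulSemiringAction G Q) (π : R →+* Q),
      Function.Surjective π ∧ (∀ (g : G) a, π (g • a) = g • π a) ∧ IsDiffSimple G Q := by
  obtain ⟨M, -, hM⟩ := zorn_le_nonempty₀ {I : Ideal R | IsDiffIdeal G I ∧ (1 : R) ∉ I} (by
    intro c hc hchain I₀ hI₀
    have hdir := hchain.directedOn
    have hmem : ∀ x, x ∈ sSup c ↔ ∃ I ∈ c, x ∈ I := fun x =>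
      Submodule.mem_sSup_of_directed ⟨I₀, hI₀⟩ hdir
    refine ⟨sSup c, ⟨fun g a ha => ?_, fun h1 => ?_⟩, fun I hI => le_sSup hI⟩
    · obtain ⟨I, hI, ha⟩ := (hmem a).1 ha
      exact (hmem _).2 ⟨I, hI, (hc hI).1 g a ha⟩
    · obtain ⟨I, hI, h1⟩ := (hmem 1).1 h1
      exact (hc hI).2 h1) ⊥ ⟨fun g a ha => by
        rw [Ideal.mem_bot] at ha ⊢; rw [ha, smul_zero], by simp⟩
  obtain ⟨⟨hMG, hM1⟩, hmax⟩ := hM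
  let ρ : G → (R ⧸ M) →+* (R ⧸ M) := fun g =>
    Ideal.quotientMap M (MulSemiringAction.toRingHom G R g) fun a ha => hMG g a ha
  let _act : MulSemiringAction G (R ⧸ M) :=
    { smul := fun g x => ρ g x
      one_smul := fun x => by
        obtain ⟨a, rfl⟩ := Ideal.Quotient.mk_surjective x
        exact congrArg (Ideal.Quotient.mk M) (one_smul G a)
      mul_smul := fun g h x => by
        obtain ⟨a, rfl⟩ := Ideal.Quotient.mk_surjective x
        exact congrArg (Ideal.Quotient.mk M) (mul_smul g h a)
      smul_zero := fun g => map_zero (ρ g)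
      smul_add := fun g => map_add (ρ g)
      smul_one := fun g => map_one (ρ g)
      smul_mul := fun g => map_mul (ρ g) }
  have hπ : ∀ (g : G) a, Ideal.Quotient.mk M (g • a) = g • Ideal.Quotient.mk M a := fun _ _ => rfl
  refine ⟨R ⧸ M, inferInstance, _act, Ideal.Quotient.mk M, Ideal.Quotient.mk_surjective, hπ,
    Ideal.Quotient.nontrivial_iff.2 ((Ideal.ne_top_iff_one M).2 hM1), fun I hI => ?_⟩
  by_cases h1 : (1 : R) ∈ I.comap (Ideal.Quotient.mk M)
  · right
    rw [Ideal.eq_top_iff_one]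
    simpa using h1
  · left
    have hle : M ≤ I.comap (Ideal.Quotient.mk M) := fun a ha => by
      rw [Ideal.mem_comap, Ideal.Quotient.eq_zero_iff_mem.2 ha]
      exact I.zero_mem
    have := hmax ⟨fun g a ha => by rw [Ideal.mem_comap, hπ]; exact hI g _ ha, h1⟩ hle
    rw [eq_bot_iff]
    intro x hx
    obtain ⟨a, rfl⟩ := Ideal.Quotient.mk_surjective x
    exact Ideal.Quotient.eq_zero_iff_mem.2 (this hx)

end Simple

/-! ### Constants of simple rings of finite type -/

theorem IsDiffClosedPseudofield.exists_mem_zeroSet_evalAt_ne_zero {G : Type*} {R : Type u}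
    [Group G] [CommRing R] [MulSemiringAction G R] (hR : IsDiffClosedPseudofield G R) {n : ℕ}
    {I : Ideal (DiffPoly G R (Fin n))} (hI : IsDiffIdeal G I) (hrad : I.IsRadical)
    {p : DiffPoly G R (Fin n)} (hp : p ∉ I) :
    ∃ a ∈ DiffPoly.zeroSet (I : Set (DiffPoly G R (Fin n))), DiffPoly.evalAt a p ≠ 0 := by
  by_contra! h
  have := hR.radical_eq n I hI
  rw [hrad.radical] at this
  exact hp (this ▸ h)

section Constants

variable {G : Type*} [CommGroup G] (H G₁ : Subgroup G)
  {K : Type u} [CommRing K] [MulSemiringAction G K]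

/-- The value of a polynomial over `K` at a point with constant coordinates; on polynomials
with constant coefficients it agrees with `DiffPoly.evalAt`. -/
noncomputable def evalConst (a : Fin 1 → FixedPoints.subring K H) :
    MvPolynomial (G₁ × Fin 1) K →+* K :=
  MvPolynomial.eval₂Hom (RingHom.id K) fun v => (v.1 • a v.2 : FixedPoints.subring K H)

theorem evalConst_map (a : Fin 1 → FixedPoints.subring K H)
    (p : MvPolynomial (G₁ × Fin 1) (FixedPoints.subring K H)) :
    evalConst H G₁ a (MvPolynomial.map (FixedPoints.subring K H).subtype p) =
      (DiffPoly.evalAt (G := G₁) (Y := Fin 1) a p : FixedPoints.subring K H) := by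
  refine (MvPolynomial.eval₂_map ..).trans (Eq.symm ?_)
  exact MvPolynomial.hom_eval₂ p (RingHom.id _) (FixedPoints.subring K H).subtype _

/-- Constant-linear functionals applied to coefficients commute with evaluation at points with
constant coordinates. -/
theorem evalAt_sum_monomial (a : Fin 1 → FixedPoints.subring K H)
    (l : K →ₗ[FixedPoints.subring K H] FixedPoints.subring K H)
    (f : MvPolynomial (G₁ × Fin 1) K) :
    DiffPoly.evalAt (G := G₁) (Y := Fin 1) a
      (∑ m ∈ f.support, MvPolynomial.monomial m (l (MvPolynomial.coeff m f)) :
        MvPolynomial (G₁ × Fin 1) (FixedPoints.subring K H)) = l (evalConst H G₁ a f) := by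
  have h1 : evalConst H G₁ a f = ∑ m ∈ f.support,
      (m.prod fun v e => (v.1 • a v.2) ^ e : FixedPoints.subring K H) •
        MvPolynomial.coeff m f := by
    rw [evalConst, MvPolynomial.coe_eval₂Hom, MvPolynomial.eval₂_eq]
    refine Finset.sum_congr rfl fun m _ => ?_
    rw [Subring.smul_def, smul_eq_mul, mul_comm, Finsupp.prod, SubmonoidClass.coe_finsetProd]
    rfl
  rw [h1, map_sum]
  refine (map_sum (MvPolynomial.eval₂Hom (RingHom.id _) _) _ _).trans ?_
  refine Finset.sum_congr rfl fun m _ => ?_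
  rw [map_smul, smul_eq_mul, mul_comm]
  exact MvPolynomial.eval₂_monomial _ _

variable {H G₁} [IsNoetherianRing K] {T : Type*} [CommRing T] [Algebra K T]
  [MulSemiringAction G T]

/-- No new constants: a simple `G`-ring of finite type over a Noetherian `G`-pseudofield `K` has no
`H`-constants outside `K`, if the `H`-constants `C` of `K` are difference closed for a finite
complementary group `G₁`.

Let `d ∈ T` be an `H`-constant and let `J ⊆ K[g y | g ∈ G₁]` be the ideal of relations between its
translates. By Chevalley's theorem there is `b ∉ J` such that primes that contain `J` but not `b`
lift to `T`. Points of `C` that annihilate the relations with constant coefficients annihilate `J`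
by descent, and closedness provides such a point `c` with `b(c) ≠ 0`. The prime of `T` so obtained
contains all translates of `d - c`; as `T` is simple, `d = c`. -/
theorem exists_algebraMap_eq_of_forall_smul_eq [Finite G₁]
    (hG : ∀ g : G, ∃ g₁ ∈ G₁, ∃ h ∈ H, g = g₁ * h) (hK : IsPseudofield G K)
    (hC : IsDiffClosedPseudofield G₁ (FixedPoints.subring K H))
    (hsmul : ∀ (g : G) (a : K), algebraMap K T (g • a) = g • algebraMap K T a)
    (hT : IsDiffSimple G T) [Algebra.FiniteType K T] {d : T} (hd : ∀ h ∈ H, h • d = d) :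
    ∃ c : K, algebraMap K T c = d := by
  have hKe : ∀ I : Ideal K, ∃ e : K, IsIdempotentElem e ∧ I = Ideal.span {e} := fun I =>
    hK.absolutelyFlat.exists_isIdempotentElem (IsNoetherian.noetherian I)
  have hss : IsSemisimpleRing (FixedPoints.subring K H) :=
    isSemisimpleRing_of_forall_exists_isIdempotentElem
      (hC.pseudofield.absolutelyFlat.exists_isIdempotentElem_of_subring _)
  have hproj : Module.Projective (FixedPoints.subring K H) K :=
    Module.projective_of_isSemisimpleRing _ _
  have := hT.nontrivial
  have := hT.isReduced
  have := hK.absolutelyFlat.isReduced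
  let q : MvPolynomial (G₁ × Fin 1) K →+* T :=
    MvPolynomial.eval₂Hom (algebraMap K T) fun v => (v.1 : G) • d
  have hqC : ∀ a, q (MvPolynomial.C a) = algebraMap K T a := MvPolynomial.eval₂Hom_C _ _
  have hqX : ∀ v, q (MvPolynomial.X v) = (v.1 : G) • d := MvPolynomial.eval₂Hom_X' _ _
  have hq : q.FiniteType := by
    refine RingHom.FiniteType.of_comp_finiteType (f := MvPolynomial.C) ?_
    rw [show q.comp MvPolynomial.C = algebraMap K T from RingHom.ext hqC]
    exact RingHom.finiteType_algebraMap.2 inferInstance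
  obtain ⟨b, hb, hlift⟩ := exists_notMem_ker_forall_isPrime_exists_comap_eq q hq
  let i : MvPolynomial (G₁ × Fin 1) (FixedPoints.subring K H) →+*
    MvPolynomial (G₁ × Fin 1) K := MvPolynomial.map (FixedPoints.subring K H).subtype
  have hstable : ∀ (h : H), ∀ f ∈ RingHom.ker q,
      MvPolynomial.map (MulSemiringAction.toRingHom H K h) f ∈ RingHom.ker q := fun h f hf => by
    have key : q.comp (MvPolynomial.map (MulSemiringAction.toRingHom H K h)) =
        (MulSemiringAction.toRingHom G T h).comp q := by
      refine MvPolynomial.ringHom_ext (fun a => ?_) fun v => ?_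
      · simp only [RingHom.comp_apply, MvPolynomial.map_C, hqC]
        exact hsmul h a
      · simp only [RingHom.comp_apply, MvPolynomial.map_X, hqX]
        exact ((smul_comm _ _ _).trans (congrArg _ (hd h h.2))).symm
    have h2 := RingHom.congr_fun key f
    simp only [RingHom.comp_apply] at h2
    rw [RingHom.mem_ker] at hf ⊢
    rw [h2, hf, map_zero]
  have hdesc := le_map_comap_subtype_of_stable (H := H) hKe (RingHom.ker q) hstable
  -- the relations with constant coefficients
  let JC : Ideal (DiffPoly G₁ (FixedPoints.subring K H) (Fin 1)) :=
    RingHom.ker (q.comp i : DiffPoly G₁ (FixedPoints.subring K H) (Fin 1) →+* T)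
  have hJC : IsDiffIdeal G₁ JC := fun g p hp => by
    have key : (q.comp i : DiffPoly G₁ (FixedPoints.subring K H) (Fin 1) →+* T).comp
        (DiffPoly.act g) = (MulSemiringAction.toRingHom G T g).comp (q.comp i) := by
      refine DiffPoly.hom_ext (fun a => ?_) fun g' v => ?_
      · rw [RingHom.comp_apply, DiffPoly.act_C]
        change q (i (MvPolynomial.C _)) = (g : G) • q (i (MvPolynomial.C _))
        simp only [i, MvPolynomial.map_C, hqC]
        exact hsmul g a
      · rw [RingHom.comp_apply, DiffPoly.act_X]
        change q (i (MvPolynomial.X _)) = (g : G) • q (i (MvPolynomial.X _))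
        simp only [i, MvPolynomial.map_X, hqX]
        exact mul_smul (g : G) (g' : G) d
    refine (RingHom.congr_fun key p).trans ?_
    exact (congrArg (fun x => (g : G) • x) (hp : q (i p) = 0)).trans (smul_zero _)
  have hrad : JC.IsRadical := fun p ⟨n, hn⟩ =>
    IsReduced.eq_zero _ ⟨n, ((q.comp i).map_pow p n).symm.trans hn⟩
  have hker : ∀ a ∈ DiffPoly.zeroSet (JC : Set (DiffPoly G₁ _ (Fin 1))),
      ∀ f ∈ RingHom.ker q, evalConst H G₁ a f = 0 := fun a ha f hf => by
    have : ((RingHom.ker q).comap i).map i ≤ RingHom.ker (evalConst H G₁ a) :=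
      Ideal.map_le_iff_le_comap.2 fun p hp => by
        rw [Ideal.mem_comap, RingHom.mem_ker, evalConst_map, ha p hp, ZeroMemClass.coe_zero]
    exact this (hdesc hf)
  obtain ⟨a, ha, hab⟩ : ∃ a ∈ DiffPoly.zeroSet (JC : Set (DiffPoly G₁ _ (Fin 1))),
      evalConst H G₁ a b ≠ 0 := by
    by_contra! h0
    refine hb (Ideal.map_comap_le (f := i) (mem_map_of_forall_mapCoeff_mem _ b fun l => ?_))
    by_contra hl
    obtain ⟨a, ha, hne⟩ := hC.exists_mem_zeroSet_evalAt_ne_zero hJC hrad hl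
    refine hne ?_
    rw [evalAt_sum_monomial, h0 a ha, map_zero]
  obtain ⟨Q, hQ, hbQ⟩ : ∃ Q : Ideal K, Q.IsPrime ∧ evalConst H G₁ a b ∉ Q := by
    by_contra! h0
    exact hab (IsReduced.eq_zero _ (nilpotent_iff_mem_prime.2 h0))
  obtain ⟨P, hP, hPQ⟩ := hlift (Q.comap (evalConst H G₁ a)) inferInstance
    (fun f hf => by rw [Ideal.mem_comap, hker a ha f hf]; exact Q.zero_mem) hbQ
  -- `a 0` is the point `c`; the translates of `d - c` are values of polynomials vanishing at `c`
  refine ⟨a 0, (sub_eq_zero.1 (hT.eq_zero_of_forall_smul_mem hP.ne_top fun g => ?_)).symm⟩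
  obtain ⟨g₁, hg₁, h, hh, rfl⟩ := hG g
  have hgd : (g₁ * h) • (d - algebraMap K T (a 0)) =
      q (MvPolynomial.X (⟨g₁, hg₁⟩, 0) - MvPolynomial.C (g₁ • (a 0 : K))) := by
    have hh' : h • ((a 0 : FixedPoints.subring K H) : K) = a 0 := (a 0).2 ⟨h, hh⟩
    rw [map_sub, hqX, hqC, smul_sub, mul_smul, mul_smul, hd h hh, ← hsmul h, hh', ← hsmul g₁]
  rw [hgd, ← Ideal.mem_comap, hPQ, Ideal.mem_comap, map_sub, evalConst,
    MvPolynomial.eval₂Hom_X', MvPolynomial.eval₂Hom_C]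
  convert Q.zero_mem
  exact sub_self _

end Constants

/-! ### Invertible matrices over difference rings -/

section Matrices

variable {G : Type*} [Group G] {n : ℕ}

/-- The action of `g` on the entries of an invertible matrix. -/
def actGL {R : Type*} [CommRing R] [MulSemiringAction G R] (g : G) :
    GL (Fin n) R →* GL (Fin n) R :=
  Matrix.GeneralLinearGroup.map (MulSemiringAction.toRingHom G R g)

section

variable {R S : Type*} [CommRing R] [CommRing S] [MulSemiringAction G R] [MulSemiringAction G S]

theorem actGL_one (B : GL (Fin n) R) : actGL (1 : G) B = B := by
  ext i j; exact one_smul _ _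

theorem actGL_mul (g h : G) (B : GL (Fin n) R) : actGL (g * h) B = actGL g (actGL h B) := by
  ext i j; exact mul_smul _ _ _

theorem map_actGL {f : R →+* S} (hf : ∀ (g : G) a, f (g • a) = g • f a) (g : G)
    (B : GL (Fin n) R) :
    Matrix.GeneralLinearGroup.map f (actGL g B) = actGL g (Matrix.GeneralLinearGroup.map f B) := by
  ext i j; exact hf g _

theorem det_inv_map (f : R →+* S) (B : GL (Fin n) R) :
    (((Matrix.GeneralLinearGroup.map f B).det⁻¹ : Sˣ) : S) = f ((B.det⁻¹ : Rˣ) : R) := by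
  rw [Matrix.GeneralLinearGroup.map_det, ← map_inv]
  rfl

theorem det_inv_actGL (g : G) (B : GL (Fin n) R) :
    (((actGL g B).det⁻¹ : Rˣ) : R) = g • ((B.det⁻¹ : Rˣ) : R) :=
  det_inv_map _ _

end

variable {K R : Type*} [CommRing K] [CommRing R] [Algebra K R]

/-- An invertible matrix comes from `GLₙ(S)` as soon as its entries and the inverse of its
determinant lie in `S`. -/
theorem mem_range_map_val_iff {S : Subalgebra K R} {B : GL (Fin n) R} :
    B ∈ (Matrix.GeneralLinearGroup.map (n := Fin n) (S.val : S →+* R)).range ↔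
      (∀ i j, B i j ∈ S) ∧ ((B.det⁻¹ : Rˣ) : R) ∈ S := by
  constructor
  · rintro ⟨B, rfl⟩
    refine ⟨fun i j => (B i j).2, ?_⟩
    rw [det_inv_map]
    exact SetLike.coe_mem _
  · rintro ⟨h, hdet⟩
    let M : Matrix (Fin n) (Fin n) S := fun i j => ⟨B i j, h i j⟩
    have hM : (M.det : R) = (B.det : Rˣ) := (RingHom.map_det (S.val : S →+* R) M)
    have hu : IsUnit M.det := IsUnit.of_mul_eq_one ⟨_, hdet⟩ <| Subtype.ext <| by
      rw [MulMemClass.coe_mul, hM]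
      exact Units.mul_inv _
    exact ⟨Matrix.GeneralLinearGroup.mk'' M hu, by ext i j; rfl⟩

theorem map_algebraMap_mem_range_map_val (S : Subalgebra K R) (B : GL (Fin n) K) :
    Matrix.GeneralLinearGroup.map (algebraMap K R) B ∈
      (Matrix.GeneralLinearGroup.map (n := Fin n) (S.val : S →+* R)).range :=
  ⟨Matrix.GeneralLinearGroup.map (algebraMap K S) B, by ext i j; rfl⟩

variable [MulSemiringAction G R]

variable (G) in
/-- The translates of the entries of `F` and of `1 / det F`. -/
def translates (F : GL (Fin n) R) : Set R :=
  {x : R | ∃ (g : G) (i j : Fin n), x = g • F i j} ∪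
    {x : R | ∃ g : G, x = g • ((F.det⁻¹ : Rˣ) : R)}

theorem adjoin_translates_le_iff {F : GL (Fin n) R} {S : Subalgebra K R} :
    Algebra.adjoin K (translates G F) ≤ S ↔
      ∀ g : G, actGL g F ∈
        (Matrix.GeneralLinearGroup.map (n := Fin n) (S.val : S →+* R)).range := by
  simp only [mem_range_map_val_iff, det_inv_actGL]
  rw [Algebra.adjoin_le_iff]
  constructor
  · exact fun h g => ⟨fun i j => h (Or.inl ⟨g, i, j, rfl⟩), h (Or.inr ⟨g, rfl⟩)⟩
  · rintro h _ (⟨g, i, j, rfl⟩ | ⟨g, rfl⟩)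
    exacts [(h g).1 i j, (h g).2]

theorem smul_mem_translates {F : GL (Fin n) R} (g : G) {x : R} (hx : x ∈ translates G F) :
    g • x ∈ translates G F := by
  rcases hx with ⟨h, i, j, rfl⟩ | ⟨h, rfl⟩
  · exact Or.inl ⟨g * h, i, j, smul_smul _ _ _⟩
  · exact Or.inr ⟨g * h, smul_smul _ _ _⟩

variable [MulSemiringAction G K]

theorem smul_mem_adjoin_translates
    (hsmul : ∀ (g : G) (a : K), algebraMap K R (g • a) = g • algebraMap K R a)
    {F : GL (Fin n) R} (g : G) {x : R} (hx : x ∈ Algebra.adjoin K (translates G F)) :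
    g • x ∈ Algebra.adjoin K (translates G F) := by
  induction hx using Algebra.adjoin_induction with
  | mem x hx => exact Algebra.subset_adjoin (smul_mem_translates g hx)
  | algebraMap a => rw [← hsmul]; exact Subalgebra.algebraMap_mem _ _
  | add x y _ _ hx hy => rw [smul_add]; exact add_mem hx hy
  | mul x y _ _ hx hy => rw [smul_mul']; exact mul_mem hx hy

/-- If `σ F = A F` with `A ∈ GLₙ(K)`, all iterates `σᵏ F` differ from `F` by a factor in
`GLₙ(K)`. -/
theorem exists_actGL_eq_of_mem_zpowers
    (hsmul : ∀ (g : G) (a : K), algebraMap K R (g • a) = g • algebraMap K R a)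
    {σ : G} {A : GL (Fin n) K} {F : GL (Fin n) R}
    (hF : actGL σ F = Matrix.GeneralLinearGroup.map (algebraMap K R) A * F)
    {h : G} (hh : h ∈ Subgroup.zpowers σ) :
    ∃ B : GL (Fin n) K, actGL h F = Matrix.GeneralLinearGroup.map (algebraMap K R) B * F := by
  let N : Subgroup G :=
    { carrier := {h | ∃ B : GL (Fin n) K,
        actGL h F = Matrix.GeneralLinearGroup.map (algebraMap K R) B * F}
      one_mem' := ⟨1, by rw [actGL_one, map_one, one_mul]⟩
      mul_mem' := by
        rintro g h ⟨B, hB⟩ ⟨B', hB'⟩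
        exact ⟨actGL g B' * B, by
          rw [actGL_mul, hB', map_mul, hB, map_mul, map_actGL hsmul, mul_assoc]⟩
      inv_mem' := by
        rintro g ⟨B, hB⟩
        refine ⟨actGL g⁻¹ B⁻¹, ?_⟩
        have := congrArg (actGL g⁻¹) hB
        rw [← actGL_mul, inv_mul_cancel, actGL_one, map_mul, ← map_actGL hsmul] at this
        rw [map_inv, map_inv, eq_inv_mul_iff_mul_eq, ← this] }
  exact (Subgroup.zpowers_le.2 (show σ ∈ N from ⟨A, hF⟩)) hh

/-- If `G` is generated by `σ` and a finite group `G₁`, the `G₁`-translates of a solution of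
`σ Y = A Y` generate the same algebra as all of its translates. -/
theorem fg_adjoin_translates
    (hsmul : ∀ (g : G) (a : K), algebraMap K R (g • a) = g • algebraMap K R a)
    {σ : G} {G₁ : Subgroup G} [Finite G₁]
    (hG : ∀ g : G, ∃ g₁ ∈ G₁, ∃ h ∈ Subgroup.zpowers σ, g = g₁ * h)
    {A : GL (Fin n) K} {F : GL (Fin n) R}
    (hF : actGL σ F = Matrix.GeneralLinearGroup.map (algebraMap K R) A * F) :
    (Algebra.adjoin K (translates G F)).FG := by
  let s : Set R := Set.range (fun v : G₁ × Fin n × Fin n => v.1 • F v.2.1 v.2.2) ∪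
    Set.range (fun g : G₁ => g • ((F.det⁻¹ : Rˣ) : R))
  have hs : s.Finite := (Set.finite_range _).union (Set.finite_range _)
  refine Subalgebra.fg_def.2 ⟨s, hs, le_antisymm (Algebra.adjoin_mono ?_) ?_⟩
  · rintro _ (⟨v, rfl⟩ | ⟨g, rfl⟩)
    exacts [Or.inl ⟨v.1, v.2.1, v.2.2, rfl⟩, Or.inr ⟨g, rfl⟩]
  · refine adjoin_translates_le_iff.2 fun g => ?_
    obtain ⟨g₁, hg₁, h, hh, rfl⟩ := hG g
    obtain ⟨B, hB⟩ := exists_actGL_eq_of_mem_zpowers hsmul hF hh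
    rw [actGL_mul, hB, map_mul, ← map_actGL hsmul]
    refine mul_mem (map_algebraMap_mem_range_map_val _ _)
      (mem_range_map_val_iff.2 ⟨fun i j => ?_, ?_⟩)
    · exact Algebra.subset_adjoin (Or.inl ⟨(⟨g₁, hg₁⟩, i, j), rfl⟩)
    · rw [det_inv_actGL]
      exact Algebra.subset_adjoin (Or.inr ⟨⟨g₁, hg₁⟩, rfl⟩)

end Matrices

/-! ### Existence -/

/-- The ring of functions `G → K`, as a `G`-ring through `(g f)(x) = g (f (g⁻¹ x))`; with this
action the constant functions form a `G`-subring isomorphic to `K`. -/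
def FunctionRing (G K : Type*) : Type _ := G → K

namespace FunctionRing

variable {G K : Type*} [CommRing K]

instance : CommRing (FunctionRing G K) := inferInstanceAs (CommRing (G → K))

instance : Algebra K (FunctionRing G K) := inferInstanceAs (Algebra K (G → K))

instance [Group G] [MulSemiringAction G K] : MulSemiringAction G (FunctionRing G K) where
  smul g f := fun x => g • f (g⁻¹ * x)
  one_smul f := funext fun x => show (1 : G) • f ((1 : G)⁻¹ * x) = f x by simp
  mul_smul g h f := funext fun x =>
    show (g * h) • f ((g * h)⁻¹ * x) = g • h • f (h⁻¹ * (g⁻¹ * x)) by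
      rw [mul_smul, mul_inv_rev, mul_assoc]
  smul_zero g := funext fun _ => smul_zero g
  smul_add g _ _ := funext fun _ => smul_add g _ _
  smul_one g := funext fun _ => smul_one g
  smul_mul g _ _ := funext fun _ => smul_mul' g _ _

/-- The value at `x`. -/
def eval (x : G) : FunctionRing G K →+* K := Pi.evalRingHom (fun _ => K) x

theorem matrix_ext {n : ℕ} {M N : Matrix (Fin n) (Fin n) (FunctionRing G K)}
    (h : ∀ x, M.map (eval x) = N.map (eval x)) : M = N := by
  ext i j
  exact funext fun x => congrFun (congrFun (h x) i) j

/-- The invertible matrix of functions with given values. -/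
def glOfFun {n : ℕ} (Φ : G → GL (Fin n) K) : GL (Fin n) (FunctionRing G K) where
  val := Matrix.of fun i j => (fun x => Φ x i j : G → K)
  inv := Matrix.of fun i j => (fun x => (Φ x)⁻¹ i j : G → K)
  val_inv := matrix_ext fun x => by
    rw [Matrix.map_mul, Matrix.map_one _ (map_zero _) (map_one _)]
    exact (Φ x).mul_inv
  inv_val := matrix_ext fun x => by
    rw [Matrix.map_mul, Matrix.map_one _ (map_zero _) (map_one _)]
    exact (Φ x).inv_mul

theorem gl_ext {n : ℕ} {M N : GL (Fin n) (FunctionRing G K)}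
    (h : ∀ x, Matrix.GeneralLinearGroup.map (eval x) M =
      Matrix.GeneralLinearGroup.map (eval x) N) : M = N :=
  Units.ext (matrix_ext fun x => congrArg Units.val (h x))

theorem map_eval_glOfFun {n : ℕ} (Φ : G → GL (Fin n) K) (x : G) :
    Matrix.GeneralLinearGroup.map (eval x) (glOfFun Φ) = Φ x := by
  ext i j; rfl

end FunctionRing

section PicardVessiot

variable {s : ℕ} (t : Fin s → ℕ) {K : Type*} [CommRing K] {n : ℕ} (A : GL (Fin n) K)

theorem isFundamentalMatrix_iff {R : Type*} [CommRing R] [Algebra K R]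
    [MulSemiringAction (SigmaGroup t) R] {F : GL (Fin n) R} :
    IsFundamentalMatrix t A F ↔
      actGL (sigma t) F = Matrix.GeneralLinearGroup.map (algebraMap K R) A * F :=
  ⟨fun h => Units.ext h, fun h => congrArg Units.val h⟩

variable [MulSemiringAction (SigmaGroup t) K]

/-- The functions `Σ → GLₙ(K)` whose value at `(k, τ)` is `θᵏ(1)`, for `θ(B) = A⁻¹ σ(B)`, solve the
equation `σ Y = A Y` over the ring of functions `Σ → K`. -/
theorem exists_isFundamentalMatrix_functionRing :
    ∃ F : GL (Fin n) (FunctionRing (SigmaGroup t) K), IsFundamentalMatrix t A F := by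
  let θ : Equiv.Perm (GL (Fin n) K) :=
    { toFun := fun B => A⁻¹ * actGL (sigma t) B
      invFun := fun B => actGL (sigma t)⁻¹ (A * B)
      left_inv := fun B => by
        beta_reduce
        rw [mul_inv_cancel_left, ← actGL_mul, inv_mul_cancel, actGL_one]
      right_inv := fun B => by
        beta_reduce
        rw [← actGL_mul, mul_inv_cancel, actGL_one, inv_mul_cancel_left] }
  let Φ : SigmaGroup t → GL (Fin n) K := fun x => (θ ^ x.toAdd.1) 1
  have hΦ : ∀ x, Φ x = A⁻¹ * actGL (sigma t) (Φ ((sigma t)⁻¹ * x)) := fun x => by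
    have hx : x.toAdd.1 = 1 + ((sigma t)⁻¹ * x).toAdd.1 := by
      simp [sigma]
    simp only [Φ]
    rw [hx, zpow_add, zpow_one]
    rfl
  refine ⟨FunctionRing.glOfFun Φ, (isFundamentalMatrix_iff t A).2
    (FunctionRing.gl_ext fun x => ?_)⟩
  have h1 : Matrix.GeneralLinearGroup.map (FunctionRing.eval x)
      (actGL (sigma t) (FunctionRing.glOfFun Φ)) =
      actGL (sigma t) (Φ ((sigma t)⁻¹ * x)) := by
    ext i j; rfl
  have h2 : Matrix.GeneralLinearGroup.map (FunctionRing.eval x) (Matrix.GeneralLinearGroup.map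
      (algebraMap K (FunctionRing (SigmaGroup t) K)) A) = A := by
    ext i j; rfl
  rw [h1, map_mul, h2, FunctionRing.map_eval_glOfFun, hΦ x, mul_inv_cancel_left]

/-- The subring generated over `K` by a solution in the ring of functions `Σ → K` is stable under
`Σ`, and its simple quotients are Picard–Vessiot rings. -/
theorem exists_isPicardVessiotRing {K : Type u} [CommRing K] [MulSemiringAction (SigmaGroup t) K]
    (hK : IsDiffSimple (SigmaGroup t) K) (A : GL (Fin n) K) :
    ∃ (R : Type u) (_ : CommRing R) (_ : Algebra K R) (_ : MulSemiringAction (SigmaGroup t) R),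
      IsPicardVessiotRing t A R := by
  have := hK.nontrivial
  obtain ⟨F, hF⟩ := exists_isFundamentalMatrix_functionRing t A
  let L := FunctionRing (SigmaGroup t) K
  have hL : ∀ (g : SigmaGroup t) (a : K), algebraMap K L (g • a) = g • algebraMap K L a :=
    fun _ _ => rfl
  have : Nontrivial L := inferInstanceAs (Nontrivial (SigmaGroup t → K))
  let S : Subalgebra K L := Algebra.adjoin K (translates (SigmaGroup t) F)
  let _act : MulSemiringAction (SigmaGroup t) S :=
    { smul := fun g x => ⟨g • (x : L), smul_mem_adjoin_translates hL g x.2⟩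
      one_smul := fun x => Subtype.ext (one_smul _ _)
      mul_smul := fun g h x => Subtype.ext (mul_smul _ _ _)
      smul_zero := fun g => Subtype.ext (smul_zero _)
      smul_add := fun g x y => Subtype.ext (smul_add _ _ _)
      smul_one := fun g => Subtype.ext (smul_one _)
      smul_mul := fun g x y => Subtype.ext (smul_mul' _ _ _) }
  obtain ⟨F₀, hF₀⟩ : F ∈ (Matrix.GeneralLinearGroup.map (n := Fin n) (S.val : S →+* L)).range := by
    have := adjoin_translates_le_iff.1 (le_refl S) 1
    rwa [actGL_one] at this
  have hF₀A : actGL (sigma t) F₀ = Matrix.GeneralLinearGroup.map (algebraMap K S) A * F₀ := by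
    have key : Matrix.GeneralLinearGroup.map (S.val : S →+* L) (actGL (sigma t) F₀) =
        Matrix.GeneralLinearGroup.map (S.val : S →+* L)
          (Matrix.GeneralLinearGroup.map (algebraMap K S) A * F₀) := by
      rw [map_actGL (fun _ _ => rfl), map_mul, hF₀, (isFundamentalMatrix_iff t A).1 hF,
        ← Matrix.GeneralLinearGroup.map_comp_apply]
      rfl
    ext i j
    exact (Matrix.GeneralLinearGroup.ext_iff _ _).1 key i j
  have hF₀_apply : ∀ i j, F i j = (F₀ i j : L) := fun i j => by
    rw [← hF₀]; rfl
  have hF₀_det : ((F.det⁻¹ : Lˣ) : L) = ((F₀.det⁻¹ : Sˣ) : S) := by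
    rw [← hF₀, det_inv_map]; rfl
  obtain ⟨Q, _, _, π, hπ, hπG, hQ⟩ := exists_isDiffSimple_quotient (SigmaGroup t) S
  let _alg : Algebra K Q := (π.comp (algebraMap K S)).toAlgebra
  have := hQ.nontrivial
  have hQsmul : ∀ (g : SigmaGroup t) (a : K), algebraMap K Q (g • a) = g • algebraMap K Q a :=
    fun g a => hπG g (algebraMap K S a)
  refine ⟨Q, inferInstance, _alg, inferInstance, hK.injective (algebraMap K Q) hQsmul, hQsmul, hQ,
    Matrix.GeneralLinearGroup.map π F₀, (isFundamentalMatrix_iff t A).2 ?_, ?_⟩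
  · rw [← map_actGL hπG, hF₀A, map_mul]
    rfl
  · change Algebra.adjoin K (translates (SigmaGroup t) (Matrix.GeneralLinearGroup.map π F₀)) = ⊤
    have key : ∀ x (hx : x ∈ S), π ⟨x, hx⟩ ∈ Algebra.adjoin K
        (translates (SigmaGroup t) (Matrix.GeneralLinearGroup.map π F₀)) := fun x hx => by
      induction hx using Algebra.adjoin_induction with
      | mem x hx =>
        refine Algebra.subset_adjoin ?_
        rcases hx with ⟨g, i, j, rfl⟩ | ⟨g, rfl⟩
        · exact Or.inl ⟨g, i, j, Eq.trans
            (congrArg π (Subtype.ext (congrArg (g • ·) (hF₀_apply i j)))) (hπG g (F₀ i j))⟩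
        · refine Or.inr ⟨g, ?_⟩
          rw [det_inv_map, ← hπG]
          exact congrArg π (Subtype.ext (congrArg (g • ·) hF₀_det))
      | algebraMap a => exact Subalgebra.algebraMap_mem _ a
      | add x y hx hy hx' hy' =>
        exact (map_add π ⟨x, hx⟩ ⟨y, hy⟩) ▸ add_mem hx' hy'
      | mul x y hx hy hx' hy' =>
        exact (map_mul π ⟨x, hx⟩ ⟨y, hy⟩) ▸ mul_mem hx' hy'
    rw [eq_top_iff]
    intro y _
    obtain ⟨⟨x, hx⟩, rfl⟩ := hπ y
    exact key x hx

end PicardVessiot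

/-! ### Uniqueness -/

section Compositum

open TensorProduct

/-- Two nonzero `G`-rings over `K` map to a simple one, a simple quotient of their tensor product:
`g` acts on `R₁ ⊗ R₂` as the tensor product of two maps that are semilinear with respect to the
action on `K`. -/
theorem exists_isDiffSimple_compositum {G : Type*} [Group G] {K : Type u} [CommRing K]
    [IsSemisimpleRing K] [MulSemiringAction G K]
    {R₁ : Type v} [CommRing R₁] [Nontrivial R₁] [Algebra K R₁] [MulSemiringAction G R₁]
    {R₂ : Type w} [CommRing R₂] [Algebra K R₂] [MulSemiringAction G R₂]
    [Algebra.FiniteType K R₁] [Algebra.FiniteType K R₂]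
    (h₁ : ∀ (g : G) (a : K), algebraMap K R₁ (g • a) = g • algebraMap K R₁ a)
    (h₂ : ∀ (g : G) (a : K), algebraMap K R₂ (g • a) = g • algebraMap K R₂ a)
    (hinj : Function.Injective (algebraMap K R₂)) :
    ∃ (T : Type (max v w)) (_ : CommRing T) (_ : Algebra K T) (_ : MulSemiringAction G T)
      (ι₁ : R₁ →ₐ[K] T) (ι₂ : R₂ →ₐ[K] T),
      (∀ (g : G) a, ι₁ (g • a) = g • ι₁ a) ∧ (∀ (g : G) a, ι₂ (g • a) = g • ι₂ a) ∧
      IsDiffSimple G T ∧ Algebra.FiniteType K T := by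
  have : Module.Projective K R₁ := Module.projective_of_isSemisimpleRing _ _
  have : Nontrivial (R₁ ⊗[K] R₂) :=
    (Algebra.TensorProduct.includeLeft_injective (S := K) (A := R₁) hinj).nontrivial
  let f₁ : ∀ g : G, R₁ →ₛₗ[MulSemiringAction.toRingHom G K g] R₁ := fun g =>
    { toFun := fun x => g • x
      map_add' := smul_add g
      map_smul' := fun a x => by
        rw [Algebra.smul_def, smul_mul', ← h₁, ← Algebra.smul_def]; rfl }
  let f₂ : ∀ g : G, R₂ →ₛₗ[MulSemiringAction.toRingHom G K g] R₂ := fun g =>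
    { toFun := fun x => g • x
      map_add' := smul_add g
      map_smul' := fun a x => by
        rw [Algebra.smul_def, smul_mul', ← h₂, ← Algebra.smul_def]; rfl }
  let ρ : G → R₁ ⊗[K] R₂ → R₁ ⊗[K] R₂ := fun g => TensorProduct.map (f₁ g) (f₂ g)
  have hρ : ∀ g x y, ρ g (x ⊗ₜ y) = (g • x) ⊗ₜ (g • y) := fun _ _ _ => rfl
  have hρ_add : ∀ g x y, ρ g (x + y) = ρ g x + ρ g y := fun g => map_add _
  have hρ_zero : ∀ g, ρ g 0 = 0 := fun g => map_zero _
  let _act : MulSemiringAction G (R₁ ⊗[K] R₂) :=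
    { smul := ρ
      one_smul := fun x => by
        change ρ 1 x = x
        induction x with
        | zero => exact hρ_zero 1
        | tmul a b => rw [hρ, one_smul, one_smul]
        | add x y hx hy => rw [hρ_add, hx, hy]
      mul_smul := fun g h x => by
        change ρ (g * h) x = ρ g (ρ h x)
        induction x with
        | zero => simp only [hρ_zero]
        | tmul a b => simp only [hρ, mul_smul]
        | add x y hx hy => simp only [hρ_add, hx, hy]
      smul_zero := hρ_zero
      smul_add := hρ_add
      smul_one := fun g => by
        change ρ g (1 ⊗ₜ 1) = 1 ⊗ₜ 1
        rw [hρ, smul_one, smul_one]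
      smul_mul := fun g x y => by
        change ρ g (x * y) = ρ g x * ρ g y
        induction x with
        | zero => simp only [zero_mul, hρ_zero]
        | add x x' hx hx' => simp only [add_mul, hρ_add, hx, hx']
        | tmul a b =>
          induction y with
          | zero => simp only [mul_zero, hρ_zero]
          | add y y' hy hy' => simp only [mul_add, hρ_add, hy, hy']
          | tmul c d => simp only [Algebra.TensorProduct.tmul_mul_tmul, hρ, smul_mul'] }
  obtain ⟨T, _, _, π, hπ, hπG, hT⟩ := exists_isDiffSimple_quotient G (R₁ ⊗[K] R₂)
  let _alg : Algebra K T := (π.comp (algebraMap K (R₁ ⊗[K] R₂))).toAlgebra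
  let πK : R₁ ⊗[K] R₂ →ₐ[K] T := { π with commutes' := fun _ => rfl }
  refine ⟨T, inferInstance, _alg, inferInstance,
    πK.comp Algebra.TensorProduct.includeLeft, πK.comp Algebra.TensorProduct.includeRight,
    fun g a => ?_, fun g a => ?_, hT, ?_⟩
  · refine Eq.trans (congrArg π ?_) (hπG g (a ⊗ₜ 1))
    exact ((hρ g a 1).trans (by rw [smul_one]; rfl)).symm
  · refine Eq.trans (congrArg π ?_) (hπG g (1 ⊗ₜ a))
    exact ((hρ g 1 a).trans (by rw [smul_one]; rfl)).symm
  · have : Algebra.FiniteType K (R₁ ⊗[K] R₂) :=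
      Algebra.FiniteType.trans (S := R₁) inferInstance inferInstance
    exact Algebra.FiniteType.of_surjective πK hπ

end Compositum

section Comparison

variable {s : ℕ} (t : Fin s → ℕ)

instance [∀ i, NeZero (t i)] : Finite (sigmaOne t) := by
  refine Finite.of_injective (fun g : sigmaOne t => (g : SigmaGroup t).toAdd.2) fun g h hgh => ?_
  refine Subtype.ext (Multiplicative.toAdd.injective (Prod.ext ?_ hgh))
  exact (show (g : SigmaGroup t).toAdd.1 = 0 from g.2).trans
    (show (h : SigmaGroup t).toAdd.1 = 0 from h.2).symm

theorem exists_mem_sigmaOne_mul_mem_sigmaZero (g : SigmaGroup t) :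
    ∃ g₁ ∈ sigmaOne t, ∃ h ∈ sigmaZero t, g = g₁ * h := by
  refine ⟨g * (sigma t ^ g.toAdd.1)⁻¹, ?_, sigma t ^ g.toAdd.1,
    Subgroup.zpow_mem_zpowers _ _, (inv_mul_cancel_right _ _).symm⟩
  change (g * (sigma t ^ g.toAdd.1)⁻¹).toAdd.1 = 0
  simp [sigma]

variable {t} {K : Type u} [CommRing K] {n : ℕ} {A : GL (Fin n) K}

theorem IsPicardVessiotRing.finiteType [∀ i, NeZero (t i)] [MulSemiringAction (SigmaGroup t) K]
    {R : Type*} [CommRing R] [Algebra K R] [MulSemiringAction (SigmaGroup t) R]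
    (hR : IsPicardVessiotRing t A R) :
    Algebra.FiniteType K R := by
  obtain ⟨F, hF, htop⟩ := hR.exists_fundamentalMatrix
  have := fg_adjoin_translates hR.algebraMap_smul (G₁ := sigmaOne t)
    (exists_mem_sigmaOne_mul_mem_sigmaZero t) ((isFundamentalMatrix_iff t A).1 hF)
  exact ⟨htop ▸ this⟩

variable {T : Type*} [CommRing T] [Algebra K T] [MulSemiringAction (SigmaGroup t) T]

/-- Two solutions of `σ Y = A Y` differ by an invertible matrix of `σ`-constants. If all constants
lie in `K`, they generate the same subalgebra. -/
theorem adjoin_translates_le_of_isFundamentalMatrix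
    (hconst : ∀ d : T, sigma t • d = d → ∃ c : K, algebraMap K T c = d)
    {F₁ F₂ : GL (Fin n) T} (hF₁ : IsFundamentalMatrix t A F₁) (hF₂ : IsFundamentalMatrix t A F₂) :
    Algebra.adjoin K (translates (SigmaGroup t) F₂) ≤
      Algebra.adjoin K (translates (SigmaGroup t) F₁) := by
  rw [isFundamentalMatrix_iff] at hF₁ hF₂
  set S := Algebra.adjoin K (translates (SigmaGroup t) F₁) with hS
  have hZ : actGL (sigma t) (F₁⁻¹ * F₂) = F₁⁻¹ * F₂ := by
    rw [map_mul, map_inv, hF₁, hF₂, mul_inv_rev, mul_assoc, inv_mul_cancel_left]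
  have hmem : ∀ d : T, sigma t • d = d → d ∈ S := fun d hd => by
    obtain ⟨c, rfl⟩ := hconst d hd
    exact S.algebraMap_mem c
  refine adjoin_translates_le_iff.2 fun g => ?_
  have hgZ : actGL (sigma t) (actGL g (F₁⁻¹ * F₂)) = actGL g (F₁⁻¹ * F₂) := by
    rw [← actGL_mul, mul_comm, actGL_mul, hZ]
  have hF : actGL g F₂ = actGL g F₁ * actGL g (F₁⁻¹ * F₂) := by
    rw [← map_mul, mul_inv_cancel_left]
  rw [hF]
  refine mul_mem (adjoin_translates_le_iff.1 hS.ge g) (mem_range_map_val_iff.2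
    ⟨fun i j => hmem _ ?_, hmem _ ?_⟩)
  · exact (Matrix.GeneralLinearGroup.ext_iff _ _).1 hgZ i j
  · rw [← det_inv_actGL, hgZ]

/-- The image of a Picard–Vessiot ring is generated by the translates of the image of a fundamental
matrix, which is again a fundamental matrix. -/
theorem IsPicardVessiotRing.exists_range_eq_adjoin [MulSemiringAction (SigmaGroup t) K]
    {R : Type*} [CommRing R] [Algebra K R] [MulSemiringAction (SigmaGroup t) R]
    (hR : IsPicardVessiotRing t A R) (f : R →ₐ[K] T)
    (hf : ∀ (g : SigmaGroup t) a, f (g • a) = g • f a) :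
    ∃ F : GL (Fin n) T, IsFundamentalMatrix t A F ∧
      f.range = Algebra.adjoin K (translates (SigmaGroup t) F) := by
  obtain ⟨F, hF, htop⟩ := hR.exists_fundamentalMatrix
  refine ⟨Matrix.GeneralLinearGroup.map (f : R →+* T) F, (isFundamentalMatrix_iff t A).2 ?_, ?_⟩
  · rw [← map_actGL (f := (f : R →+* T)) hf, (isFundamentalMatrix_iff t A).1 hF, map_mul]
    congr 1
    ext i j
    exact f.commutes _
  · change Algebra.adjoin K (translates (SigmaGroup t) F) = ⊤ at htop
    rw [← Algebra.map_top, ← htop, AlgHom.map_adjoin]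
    congr 1
    ext x
    simp only [translates, Set.image_union, det_inv_map]
    constructor
    · rintro (⟨_, ⟨g, i, j, rfl⟩, rfl⟩ | ⟨_, ⟨g, rfl⟩, rfl⟩)
      exacts [Or.inl ⟨g, i, j, hf _ _⟩, Or.inr ⟨g, hf _ _⟩]
    · rintro (⟨g, i, j, rfl⟩ | ⟨g, rfl⟩)
      exacts [Or.inl ⟨_, ⟨g, i, j, rfl⟩, hf _ _⟩, Or.inr ⟨_, ⟨g, rfl⟩, hf _ _⟩]

end Comparison

end DifferenceAlgebra

open DifferenceAlgebra
theorem mainTheorem7 {s : ℕ} (t : Fin s → ℕ) (ht : ∀ i, 2 ≤ t i)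
    (K : Type u) [CommRing K] [IsNoetherianRing K] [MulSemiringAction (SigmaGroup t) K]
    (hK : IsPseudofield (SigmaGroup t) K)
    (hC : IsDiffClosedPseudofield (sigmaOne t) (FixedPoints.subring K (sigmaZero t)))
    (n : ℕ) (A : GL (Fin n) K) :
    (∃ (R : Type u) (_ : CommRing R) (_ : Algebra K R) (_ : MulSemiringAction (SigmaGroup t) R),
      IsPicardVessiotRing t A R) ∧
    ∀ (R₁ : Type v) [CommRing R₁] [Algebra K R₁] [MulSemiringAction (SigmaGroup t) R₁]
      (R₂ : Type w) [CommRing R₂] [Algebra K R₂] [MulSemiringAction (SigmaGroup t) R₂],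
      IsPicardVessiotRing t A R₁ → IsPicardVessiotRing t A R₂ →
      ∃ e : R₁ ≃ₐ[K] R₂, ∀ (g : SigmaGroup t) (r : R₁), e (g • r) = g • e r := by
  have : ∀ i, NeZero (t i) := fun i => ⟨by have := ht i; omega⟩
  refine ⟨exists_isPicardVessiotRing t hK.simple A, ?_⟩
  intro R₁ _ _ _ R₂ _ _ _ hR₁ hR₂
  have : IsSemisimpleRing K := isSemisimpleRing_of_forall_exists_isIdempotentElem fun I =>
    hK.absolutelyFlat.exists_isIdempotentElem (IsNoetherian.noetherian I)
  have := hR₁.simple.nontrivial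
  have := hR₁.finiteType
  have := hR₂.finiteType
  obtain ⟨T, _, _, _, ι₁, ι₂, hι₁, hι₂, hT, _⟩ := exists_isDiffSimple_compositum
    hR₁.algebraMap_smul hR₂.algebraMap_smul hR₂.algebraMap_injective
  have := hT.nontrivial
  have hinj₁ : Function.Injective ι₁ := hR₁.simple.injective (ι₁ : R₁ →+* T) hι₁
  have hinj₂ : Function.Injective ι₂ := hR₂.simple.injective (ι₂ : R₂ →+* T) hι₂
  have hTsmul : ∀ (g : SigmaGroup t) (a : K), algebraMap K T (g • a) = g • algebraMap K T a :=
    fun g a => by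
      rw [← ι₁.commutes, hR₁.algebraMap_smul, hι₁, ι₁.commutes]
  have hconst : ∀ d : T, sigma t • d = d → ∃ c : K, algebraMap K T c = d := fun d hd =>
    exists_algebraMap_eq_of_forall_smul_eq (exists_mem_sigmaOne_mul_mem_sigmaZero t) hK hC hTsmul
      hT fun h hh => (Subgroup.zpowers_le (H := MulAction.stabilizer (SigmaGroup t) d)).2 hd hh
  obtain ⟨F₁, hF₁, hr₁⟩ := hR₁.exists_range_eq_adjoin ι₁ hι₁
  obtain ⟨F₂, hF₂, hr₂⟩ := hR₂.exists_range_eq_adjoin ι₂ hι₂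
  have hrange : ι₁.range = ι₂.range := by
    rw [hr₁, hr₂]
    exact le_antisymm (adjoin_translates_le_of_isFundamentalMatrix hconst hF₂ hF₁)
      (adjoin_translates_le_of_isFundamentalMatrix hconst hF₁ hF₂)
  let e : R₁ ≃ₐ[K] R₂ := (AlgEquiv.ofInjective ι₁ hinj₁).trans
    ((Subalgebra.equivOfEq _ _ hrange).trans (AlgEquiv.ofInjective ι₂ hinj₂).symm)
  have he : ∀ r, ι₂ (e r) = ι₁ r := fun r =>
    congrArg Subtype.val ((AlgEquiv.ofInjective ι₂ hinj₂).apply_symm_apply _)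
  exact ⟨e, fun g r => hinj₂ (by rw [he, hι₁, hι₂, he])⟩
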